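/- Let $m\ge n\ge 1$, $A\in\mathbb R^{m\times n}$, $b\in\mathbb R^m$. The total least squares (TLS) problem is to minimize $\|[E,\ f]\|_F$ over $E\in\mathbb R^{m\times n}$, $f\in\mathbb R^m$ subject to $b+f\in\mathscr R(A+E)$ (the range of $A+E$); a TLS solution is any $x\in\mathbb R^n$ with $(A+E)x=b+f$ for a minimizing $[E,\ f]$. Let $\sigma_{n+1}$ be the $(n+1)$-st largest singular value of $[A,\ b]$ (with $\sigma_{n+1}=0$ if $m=n$) and $\widetilde\sigma_n$ the $n$-th largest singular value of $A$, and assume the genericity condition $\widetilde\sigma_n>\sigma_{n+1}$. Then $A^{\mathrm T}A-\sigma_{n+1}^2I$ is invertible and there is a unique TLS solution $x$. With $r=b-Ax$, $$\left\|\left(A^{\mathrm T}A-\sigma_{n+1}^2I\right)^{-1}\left(A^{\mathrm T}+\frac{2xr^{\mathrm T}}{1+x^{\mathrm T}x}\right)\right\|_2=\left\|\left(A^{\mathrm T}A-\sigma_{n+1}^2I\right)^{-1}A^{\mathrm T}\right\|_2 .$$ Moreover there are $\varepsilon>0$ and $C\in\mathbb R$, depending only on $A$ and $b$, such that for all $\delta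 A\in\mathbb R^{m\times n}$ and $\delta b\in\mathbb R^m$ with $\|[\delta A,\ \delta b]\|_F<\varepsilon$ the TLS problem for $[A+\delta A,\ b+\delta b]$ has a unique solution $x+\delta x$ and, if $x\ne 0$, $$\begin{aligned}\frac{\|\delta x\|_2}{\|x\|_2}\le{}&\left(\frac{\|b\|_2}{\|x\|_2}\left\|\left(A^{\mathrm T}A-\sigma_{n+1}^2I\right)^{-1}A^{\mathrm T}\right\|_2\right)\frac{\|\delta b\|_2}{\|b\|_2}\\&+\left[\frac{\|A\|_2\|r\|_2}{\|x\|_2}\left\|\left(A^{\mathrm T}A-\sigma_{n+1}^2I\right)^{-1}\right\|_2+\|A\|_2\left\|\left(A^{\mathrm T}A-\sigma_{n+1}^2I\right)^{-1}A^{\mathrm T}\right\|_2\right]\frac{\|\delta A\|_2}{\|A\|_2}+C\,\|[\delta A,\ \delta b]\|_F^2 .\end{aligned}$$ Here $\|\cdot\|_2$ is the Euclidean norm of vectors and the spectral norm of matrices, and $\|\cdot\|_F$ is the Frobenius norm. -/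

import Mathlib

open scoped Matrix

noncomputable section

namespace TLS

/-- The spectral norm `‖M‖₂`: the operator norm of `M` with respect to Euclidean norms. -/
def specNorm {ι κ : Type*} [Fintype ι] [Fintype κ] [DecidableEq κ] (M : Matrix ι κ ℝ) : ℝ :=
  ‖LinearMap.toContinuousLinearMap (Matrix.toEuclideanLin M)‖

/-- The Frobenius norm `‖M‖_F`. -/
def frobNorm {ι κ : Type*} [Fintype ι] [Fintype κ] (M : Matrix ι κ ℝ) : ℝ :=
  Real.sqrt (∑ i, ∑ j, M i j ^ 2)

/-- The `k`-th largest singular value `σ_k` of `M`, for `k ≥ 1` (Mathlib counts from `0`).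
It is `0` as soon as `k` exceeds the number of rows or the number of columns. -/
def singVal {ι κ : Type*} [Fintype ι] [Fintype κ] [DecidableEq κ] (M : Matrix ι κ ℝ)
    (k : ℕ) : ℝ :=
  (Matrix.toEuclideanLin M).singularValues (k - 1)

/-- The augmented matrix `[A, b]`. -/
def augment {m n : ℕ} (A : Matrix (Fin m) (Fin n) ℝ) (b : EuclideanSpace ℝ (Fin m)) :
    Matrix (Fin m) (Fin n ⊕ Unit) ℝ :=
  Matrix.fromCols A (Matrix.replicateCol Unit b.ofLp)

/-- The constraint `b + f ∈ ℛ(A + E)`. -/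
def IsFeasible {m n : ℕ} (A : Matrix (Fin m) (Fin n) ℝ) (b : EuclideanSpace ℝ (Fin m))
    (E : Matrix (Fin m) (Fin n) ℝ) (f : EuclideanSpace ℝ (Fin m)) : Prop :=
  b + f ∈ LinearMap.range (Matrix.toEuclideanLin (A + E))

/-- `[E, f]` solves `min ‖[E, f]‖_F` subject to `b + f ∈ ℛ(A + E)`. -/
def IsMinimizer {m n : ℕ} (A : Matrix (Fin m) (Fin n) ℝ) (b : EuclideanSpace ℝ (Fin m))
    (E : Matrix (Fin m) (Fin n) ℝ) (f : EuclideanSpace ℝ (Fin m)) : Prop :=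
  IsFeasible A b E f ∧
    ∀ (E' : Matrix (Fin m) (Fin n) ℝ) (f' : EuclideanSpace ℝ (Fin m)),
      IsFeasible A b E' f' → frobNorm (augment E f) ≤ frobNorm (augment E' f')

/-- `x` is a total least squares solution of `A x ≈ b`: it solves `(A + E) x = b + f` for some
minimizer `[E, f]` of the total least squares problem. -/
def IsSolution {m n : ℕ} (A : Matrix (Fin m) (Fin n) ℝ) (b : EuclideanSpace ℝ (Fin m))
    (x : EuclideanSpace ℝ (Fin n)) : Prop :=
  ∃ (E : Matrix (Fin m) (Fin n) ℝ) (f : EuclideanSpace ℝ (Fin m)),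
    IsMinimizer A b E f ∧ Matrix.toEuclideanLin (A + E) x = b + f

/-- The matrix `AᵀA - σ_{n+1}² I`, where `σ_{n+1}` is the `(n+1)`-st singular value of `[A, b]`. -/
def shiftedGram {m n : ℕ} (A : Matrix (Fin m) (Fin n) ℝ) (b : EuclideanSpace ℝ (Fin m)) :
    Matrix (Fin n) (Fin n) ℝ :=
  Aᵀ * A - (singVal (augment A b) (n + 1) ^ 2) • (1 : Matrix (Fin n) (Fin n) ℝ)

end TLS

end

/-!
A correction `[E, f]` with `(A + E) y = b + f` maps `(y, -1)` to the residual `b - A y`, so it has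
Frobenius norm at least `‖b - A y‖ / √(1 + ‖y‖²)`, and a rank-one correction attains this.  Hence
the total least squares solutions are the minimizers of `‖b - A y‖² / (1 + ‖y‖²)`
(`TLS.isSolution_iff`).  The infimum of this quotient is `s = σ²`, where `σ` is the smallest
singular value of `[A, b]`; if `σ` is less than the smallest singular value of `A`, it is attained
(`TLS.exists_norm_residual_sq_eq`), and `‖b - A y‖² - s (1 + ‖y‖²)` is a strictly convex quadratic
in `y`, so that its zero `x` is unique (`TLS.isSolution_iff_eq`) and satisfies the stationarity
equation `Aᵀ r + s x = 0`, where `r = b - A x`.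

With this equation and `‖r‖² = s (1 + ‖x‖²)`, the matrix `Aᵀ + 2 x rᵀ / (1 + ‖x‖²)` has the same
row Gram matrix as `Aᵀ`, which gives the equality of spectral norms
(`TLS.specNorm_inv_mul_add_rankOne`).

By Weyl's inequality for the smallest singular value, the perturbed problem is still generic, and
its smallest singular value differs from `σ` by at most `‖[δA, δb]‖_F`.  Subtracting the two
stationarity equations, and using that the quotient changes to first order by
`2 ⟪r, e⟫ / (1 + ‖x‖²)` with `e = δb - δA x`, gives
`(AᵀA - s) δx = (Aᵀ + 2 x rᵀ / (1 + ‖x‖²)) e + δAᵀ r + O(‖[δA, δb]‖_F²)` with an explicit remainder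
(`exists_first_order_expansion`); taking norms yields the bound.
-/

/-! ### The smallest singular value as an extremum of `‖T z‖ / ‖z‖` -/

section SingularValues

variable {X Y : Type*} [NormedAddCommGroup X] [InnerProductSpace ℝ X] [FiniteDimensional ℝ X]
  [NormedAddCommGroup Y] [InnerProductSpace ℝ Y] [FiniteDimensional ℝ Y]

/-- The last singular value of `T` bounds `‖T z‖ / ‖z‖` from below: expand `z` in an orthonormal
eigenbasis of `T* T`, all of whose eigenvalues are at least the last one. -/
theorem LinearMap.last_singularValue_mul_norm_le (T : X →ₗ[ℝ] Y) {k : ℕ}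
    (hk : Module.finrank ℝ X = k + 1) (z : X) : T.singularValues k * ‖z‖ ≤ ‖T z‖ := by
  have hS := T.isSymmetric_adjoint_comp_self
  set B := hS.eigenvectorBasis hk with hB
  have hTz : ‖T z‖ ^ 2 = ∑ i, hS.eigenvalues hk i * inner ℝ (B i) z ^ 2 := by
    have h1 : ‖T z‖ ^ 2 = inner ℝ ((LinearMap.adjoint T ∘ₗ T) z) z := by
      rw [LinearMap.comp_apply, LinearMap.adjoint_inner_left, real_inner_self_eq_norm_sq]
    rw [h1, ← B.sum_inner_mul_inner]
    refine Finset.sum_congr rfl fun i _ => ?_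
    rw [hS z (B i), hB, hS.apply_eigenvectorBasis hk i, RCLike.ofReal_real_eq_id, id_eq,
      inner_smul_right, real_inner_comm]
    ring
  have hz : ‖z‖ ^ 2 = ∑ i, inner ℝ (B i) z ^ 2 := by
    rw [← B.sum_sq_norm_inner_right z]
    simp
  have hsq : (T.singularValues k * ‖z‖) ^ 2 ≤ ‖T z‖ ^ 2 := by
    rw [mul_pow, hTz, hz, Finset.mul_sum]
    refine Finset.sum_le_sum fun i _ => ?_
    gcongr
    rw [T.sq_singularValues_of_lt hk (Nat.lt_succ_self k)]
    exact hS.eigenvalues_antitone hk (Fin.le_last i)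
  exact le_of_sq_le_sq hsq (norm_nonneg _)

theorem LinearMap.exists_norm_eq_last_singularValue_mul_norm (T : X →ₗ[ℝ] Y) {k : ℕ}
    (hk : Module.finrank ℝ X = k + 1) :
    ∃ z : X, z ≠ 0 ∧ ‖T z‖ = T.singularValues k * ‖z‖ := by
  obtain ⟨z, hz⟩ := (T.hasEigenvalue_adjoint_comp_self_sq_singularValues
    (n := k) (by omega)).exists_hasEigenvector
  refine ⟨z, hz.2, ?_⟩
  have hsq : ‖T z‖ ^ 2 = (T.singularValues k * ‖z‖) ^ 2 := by
    rw [← real_inner_self_eq_norm_sq, ← LinearMap.adjoint_inner_left, ← LinearMap.comp_apply,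
      hz.apply_eq_smul, real_inner_smul_left, real_inner_self_eq_norm_sq, mul_pow]
    rfl
  exact (sq_eq_sq₀ (norm_nonneg _)
    (mul_nonneg (T.singularValues_nonneg k) (norm_nonneg _))).1 hsq

/-- Weyl's inequality for the last singular value. -/
theorem LinearMap.last_singularValue_add_le (T U : X →ₗ[ℝ] Y) {k : ℕ}
    (hk : Module.finrank ℝ X = k + 1) {c : ℝ} (hU : ∀ z, ‖U z‖ ≤ c * ‖z‖) :
    (T + U).singularValues k ≤ T.singularValues k + c := by
  obtain ⟨z, hz0, hz⟩ := T.exists_norm_eq_last_singularValue_mul_norm hk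
  have h1 := (T + U).last_singularValue_mul_norm_le hk z
  have h2 := norm_add_le (T z) (U z)
  rw [LinearMap.add_apply] at h1
  refine le_of_mul_le_mul_right ?_ (norm_pos_iff.2 hz0)
  linarith [hU z, add_mul (T.singularValues k) c ‖z‖]

theorem LinearMap.abs_last_singularValue_add_sub_le (T U : X →ₗ[ℝ] Y) {k : ℕ}
    (hk : Module.finrank ℝ X = k + 1) {c : ℝ} (hU : ∀ z, ‖U z‖ ≤ c * ‖z‖) :
    |(T + U).singularValues k - T.singularValues k| ≤ c := by
  have h1 := T.last_singularValue_add_le U hk hU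
  have h2 := (T + U).last_singularValue_add_le (-U) hk (c := c) (by simpa using hU)
  rw [add_neg_cancel_right] at h2
  rw [abs_le]
  constructor <;> linarith

end SingularValues

/-! ### Frobenius norm, spectral norm and the augmented matrix -/

namespace TLS

/-- The continuous linear map between Euclidean spaces given by a matrix; its operator norm is
`specNorm` by definition. -/
noncomputable abbrev toCLM {ι κ : Type*} [Fintype ι] [Fintype κ] [DecidableEq κ]
    (M : Matrix ι κ ℝ) : EuclideanSpace ℝ κ →L[ℝ] EuclideanSpace ℝ ι :=
  LinearMap.toContinuousLinearMap (Matrix.toEuclideanLin M)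

theorem toCLM_mul_apply {ι κ μ : Type*} [Fintype ι] [Fintype κ] [Fintype μ] [DecidableEq κ]
    [DecidableEq μ] (M : Matrix ι κ ℝ) (N : Matrix κ μ ℝ) (z : EuclideanSpace ℝ μ) :
    toCLM (M * N) z = toCLM M (toCLM N z) := by
  simp [toCLM]

theorem toCLM_transpose {ι κ : Type*} [Fintype ι] [Fintype κ] [DecidableEq ι] [DecidableEq κ]
    (M : Matrix ι κ ℝ) : toCLM Mᵀ = ContinuousLinearMap.adjoint (toCLM M) := by
  rw [← Matrix.conjTranspose_eq_transpose_of_trivial, toCLM,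
    Matrix.toEuclideanLin_conjTranspose_eq_adjoint, LinearMap.adjoint_toContinuousLinearMap]

theorem frobNorm_nonneg {ι κ : Type*} [Fintype ι] [Fintype κ] (M : Matrix ι κ ℝ) :
    0 ≤ frobNorm M := Real.sqrt_nonneg _

theorem frobNorm_sq {ι κ : Type*} [Fintype ι] [Fintype κ] (M : Matrix ι κ ℝ) :
    frobNorm M ^ 2 = ∑ i, ∑ j, M i j ^ 2 :=
  Real.sq_sqrt (Finset.sum_nonneg fun _ _ => Finset.sum_nonneg fun _ _ => sq_nonneg _)

theorem norm_toCLM_apply_le {ι κ : Type*} [Fintype ι] [Fintype κ] [DecidableEq κ]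
    (M : Matrix ι κ ℝ) (z : EuclideanSpace ℝ κ) : ‖toCLM M z‖ ≤ frobNorm M * ‖z‖ := by
  refine le_of_sq_le_sq ?_ (mul_nonneg (frobNorm_nonneg M) (norm_nonneg z))
  rw [mul_pow, frobNorm_sq, EuclideanSpace.real_norm_sq_eq, EuclideanSpace.real_norm_sq_eq,
    Finset.sum_mul]
  refine Finset.sum_le_sum fun i _ => ?_
  simpa [toCLM, Matrix.mulVec, dotProduct] using
    Finset.sum_mul_sq_le_sq_mul_sq Finset.univ (M i) z.ofLp

variable {m n : ℕ}

/-- The vector `(y, t)` of `ℝⁿ⁺¹`, on the index type of the columns of `augment A b`. -/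
def append (y : EuclideanSpace ℝ (Fin n)) (t : ℝ) : EuclideanSpace ℝ (Fin n ⊕ Unit) :=
  WithLp.toLp 2 (Sum.elim y.ofLp fun _ => t)

theorem norm_append_sq (y : EuclideanSpace ℝ (Fin n)) (t : ℝ) :
    ‖append y t‖ ^ 2 = ‖y‖ ^ 2 + t ^ 2 := by
  simp [append, EuclideanSpace.real_norm_sq_eq]

theorem exists_eq_append (z : EuclideanSpace ℝ (Fin n ⊕ Unit)) : ∃ y t, z = append y t := by
  refine ⟨WithLp.toLp 2 fun i => z (Sum.inl i), z (Sum.inr ()), ?_⟩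
  ext i
  rcases i with i | i <;> simp [append]

theorem toCLM_augment_append (A : Matrix (Fin m) (Fin n) ℝ) (b : EuclideanSpace ℝ (Fin m))
    (y : EuclideanSpace ℝ (Fin n)) (t : ℝ) :
    toCLM (augment A b) (append y t) = toCLM A y + t • b := by
  ext i
  simp [toCLM, augment, append, Matrix.mulVec, dotProduct, mul_comm]

theorem augment_add (A δA : Matrix (Fin m) (Fin n) ℝ) (b δb : EuclideanSpace ℝ (Fin m)) :
    augment (A + δA) (b + δb) = augment A b + augment δA δb := by
  ext i j
  rcases j with j | j <;> simp [augment]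

theorem frobNorm_augment_sq (E : Matrix (Fin m) (Fin n) ℝ) (f : EuclideanSpace ℝ (Fin m)) :
    frobNorm (augment E f) ^ 2 = frobNorm E ^ 2 + ‖f‖ ^ 2 := by
  simp [frobNorm_sq, augment, EuclideanSpace.real_norm_sq_eq, Finset.sum_add_distrib]

theorem frobNorm_le_frobNorm_augment (E : Matrix (Fin m) (Fin n) ℝ)
    (f : EuclideanSpace ℝ (Fin m)) : frobNorm E ≤ frobNorm (augment E f) := by
  refine le_of_sq_le_sq ?_ (frobNorm_nonneg _)
  rw [frobNorm_augment_sq]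
  linarith [sq_nonneg ‖f‖]

theorem norm_le_frobNorm_augment (E : Matrix (Fin m) (Fin n) ℝ)
    (f : EuclideanSpace ℝ (Fin m)) : ‖f‖ ≤ frobNorm (augment E f) := by
  refine le_of_sq_le_sq ?_ (frobNorm_nonneg _)
  rw [frobNorm_augment_sq]
  linarith [sq_nonneg (frobNorm E)]

theorem specNorm_le_frobNorm {ι κ : Type*} [Fintype ι] [Fintype κ] [DecidableEq κ]
    (M : Matrix ι κ ℝ) : specNorm M ≤ frobNorm M :=
  ContinuousLinearMap.opNorm_le_bound _ (frobNorm_nonneg M) (norm_toCLM_apply_le M)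

/-! ### Reduction of total least squares to a quotient of norms -/

/-- Any correction `[E, f]` that makes `y` an exact solution maps `(y, -1)` to the residual. -/
theorem norm_residual_sq_le {A E : Matrix (Fin m) (Fin n) ℝ} {b f : EuclideanSpace ℝ (Fin m)}
    {y : EuclideanSpace ℝ (Fin n)} (h : Matrix.toEuclideanLin (A + E) y = b + f) :
    ‖b - toCLM A y‖ ^ 2 ≤ frobNorm (augment E f) ^ 2 * (1 + ‖y‖ ^ 2) := by
  have h1 : toCLM (augment E f) (append y (-1)) = b - toCLM A y := by
    rw [toCLM_augment_append]
    have h2 : toCLM A y + toCLM E y = b + f := by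
      rw [← h]
      simp [toCLM]
    rw [eq_sub_of_add_eq h2.symm, neg_one_smul]
    abel
  have h3 := norm_toCLM_apply_le (augment E f) (append y (-1))
  rw [h1] at h3
  have h4 := pow_le_pow_left₀ (norm_nonneg _) h3 2
  rw [mul_pow, norm_append_sq] at h4
  linarith

/-- The rank-one correction `r [yᵀ, -1] / (1 + ‖y‖²)`, where `r = b - A y`, makes `y` an exact
solution and attains the bound of `norm_residual_sq_le`. -/
theorem exists_correction (A : Matrix (Fin m) (Fin n) ℝ) (b : EuclideanSpace ℝ (Fin m))
    (y : EuclideanSpace ℝ (Fin n)) :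
    ∃ (E : Matrix (Fin m) (Fin n) ℝ) (f : EuclideanSpace ℝ (Fin m)),
      Matrix.toEuclideanLin (A + E) y = b + f ∧
      frobNorm (augment E f) ^ 2 * (1 + ‖y‖ ^ 2) = ‖b - toCLM A y‖ ^ 2 := by
  set r := b - toCLM A y with hr
  set N := 1 + ‖y‖ ^ 2 with hN
  have hN0 : N ≠ 0 := by positivity
  have hE : toCLM (N⁻¹ • Matrix.vecMulVec r.ofLp y.ofLp) y = (N⁻¹ * ‖y‖ ^ 2) • r := by
    ext i
    simp only [toCLM, LinearMap.coe_toContinuousLinearMap', Matrix.toLpLin_apply, Matrix.mulVec,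
      dotProduct, Matrix.smul_apply, Matrix.vecMulVec_apply, PiLp.smul_apply, smul_eq_mul,
      EuclideanSpace.real_norm_sq_eq, Finset.mul_sum, Finset.sum_mul]
    exact Finset.sum_congr rfl fun j _ => by ring
  refine ⟨N⁻¹ • Matrix.vecMulVec r.ofLp y.ofLp, -(N⁻¹ • r), ?_, ?_⟩
  · have h1 : Matrix.toEuclideanLin (A + N⁻¹ • Matrix.vecMulVec r.ofLp y.ofLp) y =
        toCLM A y + (N⁻¹ * ‖y‖ ^ 2) • r := by
      rw [← hE]
      simp [toCLM]
    have h2 : (N⁻¹ * ‖y‖ ^ 2) • r = r - N⁻¹ • r := by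
      rw [show N⁻¹ * ‖y‖ ^ 2 = 1 - N⁻¹ by field_simp; rw [hN]; ring, sub_smul, one_smul]
    rw [h1, h2, hr]
    abel
  · have h1 : frobNorm (N⁻¹ • Matrix.vecMulVec r.ofLp y.ofLp) ^ 2 =
        N⁻¹ ^ 2 * (‖r‖ ^ 2 * ‖y‖ ^ 2) := by
      rw [frobNorm_sq, EuclideanSpace.real_norm_sq_eq, EuclideanSpace.real_norm_sq_eq,
        Finset.sum_mul_sum, Finset.mul_sum]
      refine Finset.sum_congr rfl fun i _ => ?_
      rw [Finset.mul_sum]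
      refine Finset.sum_congr rfl fun j _ => ?_
      rw [Matrix.smul_apply, Matrix.vecMulVec_apply, smul_eq_mul]
      ring
    rw [frobNorm_augment_sq, h1, norm_neg, norm_smul, mul_pow, Real.norm_eq_abs, sq_abs]
    field_simp
    rw [hN]
    ring

theorem isSolution_iff (A : Matrix (Fin m) (Fin n) ℝ) (b : EuclideanSpace ℝ (Fin m))
    (x : EuclideanSpace ℝ (Fin n)) :
    IsSolution A b x ↔ ∀ y, ‖b - toCLM A x‖ ^ 2 / (1 + ‖x‖ ^ 2) ≤
      ‖b - toCLM A y‖ ^ 2 / (1 + ‖y‖ ^ 2) := by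
  have hpos : ∀ z : EuclideanSpace ℝ (Fin n), 0 < 1 + ‖z‖ ^ 2 := fun z => by positivity
  constructor
  · rintro ⟨E, f, ⟨-, hmin⟩, hx⟩ y
    obtain ⟨E', f', hy, hF⟩ := exists_correction A b y
    have h1 := pow_le_pow_left₀ (frobNorm_nonneg _) (hmin E' f' ⟨y, hy⟩) 2
    calc _ ≤ frobNorm (augment E f) ^ 2 := by
          rw [div_le_iff₀ (hpos x)]
          exact norm_residual_sq_le hx
      _ ≤ frobNorm (augment E' f') ^ 2 := h1
      _ = _ := by rw [eq_div_iff (hpos y).ne', hF]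
  · intro h
    obtain ⟨E, f, hx, hF⟩ := exists_correction A b x
    refine ⟨E, f, ⟨⟨x, hx⟩, fun E' f' ⟨y, hy⟩ => ?_⟩, hx⟩
    refine le_of_sq_le_sq ?_ (frobNorm_nonneg _)
    calc frobNorm (augment E f) ^ 2 = ‖b - toCLM A x‖ ^ 2 / (1 + ‖x‖ ^ 2) := by
          rw [eq_div_iff (hpos x).ne', hF]
      _ ≤ _ := h y
      _ ≤ _ := by
          rw [div_le_iff₀ (hpos y)]
          exact norm_residual_sq_le hy

end TLS

/-! ### Stationarity and the first-order expansion -/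

section Expansion

open ContinuousLinearMap (adjoint)

variable {X Y : Type*} [NormedAddCommGroup X] [InnerProductSpace ℝ X] [CompleteSpace X]
  [NormedAddCommGroup Y] [InnerProductSpace ℝ Y] [CompleteSpace Y]

/-- The Taylor expansion of the quadratic `y ↦ ‖b - A y‖² - s (1 + ‖y‖²)` about an arbitrary
point `x`. -/
theorem norm_residual_add_sq_sub (A : X →L[ℝ] Y) (b : Y) (s : ℝ) (x d : X) :
    ‖b - A (x + d)‖ ^ 2 - s * (1 + ‖x + d‖ ^ 2) =
      ‖b - A x‖ ^ 2 - s * (1 + ‖x‖ ^ 2)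
        - 2 * inner ℝ (adjoint A (b - A x) + s • x) d + (‖A d‖ ^ 2 - s * ‖d‖ ^ 2) := by
  rw [map_add, ← sub_sub, norm_sub_sq_real, norm_add_sq_real, inner_add_left,
    ContinuousLinearMap.adjoint_inner_left, real_inner_smul_left]
  ring

theorem adjoint_residual_add_smul_eq_zero {A : X →L[ℝ] Y} {b : Y} {s : ℝ} {x : X}
    (hle : ∀ y, s * (1 + ‖y‖ ^ 2) ≤ ‖b - A y‖ ^ 2)
    (hx : ‖b - A x‖ ^ 2 = s * (1 + ‖x‖ ^ 2)) :
    adjoint A (b - A x) + s • x = 0 := by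
  set g := adjoint A (b - A x) + s • x with hg
  -- along `x + t g` the quadratic is nonnegative with value `0` at `t = 0`, so its linear
  -- coefficient `-2 ‖g‖²` vanishes
  have h : ∀ t : ℝ, 0 ≤ (‖A g‖ ^ 2 - s * ‖g‖ ^ 2) * (t * t) + (-2 * ‖g‖ ^ 2) * t + 0 := by
    intro t
    have h1 := norm_residual_add_sq_sub A b s x (t • g)
    rw [← hg, map_smul, norm_smul, norm_smul, mul_pow, mul_pow, Real.norm_eq_abs, sq_abs,
      real_inner_smul_right, real_inner_self_eq_norm_sq] at h1
    nlinarith [hle (x + t • g)]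
  have h2 := discrim_le_zero h
  rw [discrim] at h2
  have h3 : ‖g‖ ^ 2 = 0 := by nlinarith
  exact norm_eq_zero.1 (pow_eq_zero_iff two_ne_zero |>.1 h3)

/-- First-order expansion of a stationary point. Let `(x, s)` be a stationary pair with residual
`r`, and let `(x + d, s')` be one for the operator `A + H`, where `e` is the residual perturbation
at `x`. The identity for `(A* A - s) d` comes from subtracting the two stationarity equations and
eliminating `s' - s` by `(s' - s) (1 + ‖x‖²) = 2 ⟪r, e⟫ + ‖e‖² - ⟪g, d⟫`, where
`g = ((A + H)* (A + H) - s') d`; all that remains is of second order. -/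
theorem exists_first_order_expansion (A : X →L[ℝ] Y) {x : X} {r : Y} {s : ℝ} (c k : ℝ) {γ : ℝ}
    (hγ : 0 < γ) (hst : adjoint A r + s • x = 0) (hr : ‖r‖ ^ 2 = s * (1 + ‖x‖ ^ 2)) :
    ∃ R : ℝ, ∀ (H : X →L[ℝ] Y) (d : X) (e : Y) (s' δ : ℝ),
      δ ≤ 1 → ‖H‖ ≤ δ → ‖e‖ ≤ c * δ → |s' - s| ≤ k * δ →
      adjoint (A + H) (r + e - (A + H) d) + s' • (x + d) = 0 →
      ‖r + e - (A + H) d‖ ^ 2 = s' * (1 + ‖x + d‖ ^ 2) →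
      γ * ‖d‖ ^ 2 ≤ ‖(A + H) d‖ ^ 2 - s' * ‖d‖ ^ 2 →
      ∃ ρ : X, ‖ρ‖ ≤ R * δ ^ 2 ∧
        adjoint A (A d) - s • d =
          adjoint A e + (2 / (1 + ‖x‖ ^ 2) * inner ℝ r e) • x + adjoint H r + ρ := by
  set M := ‖r‖ + (‖A‖ + 1) * c + k * ‖x‖ with hM
  refine ⟨c + (c ^ 2 + M * (M / γ)) * ‖x‖ + (2 * ‖A‖ + 1 + k) * (M / γ), ?_⟩
  intro H d e s' δ hδ1 hH he hs hst' hr' hcoer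
  have hδ0 : 0 ≤ δ := (norm_nonneg H).trans hH
  have hN : 1 ≤ 1 + ‖x‖ ^ 2 := by linarith [sq_nonneg ‖x‖]
  have hN0 : 1 + ‖x‖ ^ 2 ≠ 0 := by positivity
  set g := adjoint (A + H) ((A + H) d) - s' • d with hg
  have hgd : inner ℝ g d = ‖(A + H) d‖ ^ 2 - s' * ‖d‖ ^ 2 := by
    rw [hg, inner_sub_left, ContinuousLinearMap.adjoint_inner_left, real_inner_smul_left,
      real_inner_self_eq_norm_sq, real_inner_self_eq_norm_sq]
  have hg_eq : g = adjoint H r + adjoint (A + H) e + (s' - s) • x := by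
    have h1 : g = adjoint H r + adjoint (A + H) e + (s' - s) • x + (adjoint A r + s • x) -
        (adjoint (A + H) (r + e - (A + H) d) + s' • (x + d)) := by
      rw [hg]
      simp only [map_add, map_sub, add_apply, smul_add, sub_smul]
      abel
    rw [h1, hst, hst', add_zero, sub_zero]
  have hs_eq : s' - s = 2 / (1 + ‖x‖ ^ 2) * inner ℝ r e +
      (‖e‖ ^ 2 - inner ℝ g d) / (1 + ‖x‖ ^ 2) := by
    -- expand about the new stationary point `x + d`, in the direction `-d`
    have h1 := norm_residual_add_sq_sub (A + H) (r + e + (A + H) x) s' (x + d) (-d)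
    have h2 : r + e + (A + H) x - (A + H) (x + d) = r + e - (A + H) d := by
      rw [map_add]
      abel
    rw [h2, hst', hr', add_neg_cancel_right, add_sub_cancel_right, map_neg, norm_neg, norm_neg,
      inner_zero_left, ← hgd, norm_add_sq_real, hr] at h1
    field_simp
    linarith
  have hadj : ∀ (T : X →L[ℝ] Y) (z : Y), ‖adjoint T z‖ ≤ ‖T‖ * ‖z‖ := fun T z => by
    simpa using (adjoint T).le_opNorm z
  have hAH : ‖A + H‖ ≤ ‖A‖ + 1 := (norm_add_le A H).trans (by linarith)
  have hgM : ‖g‖ ≤ M * δ := by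
    calc ‖g‖ ≤ ‖adjoint H r‖ + ‖adjoint (A + H) e‖ + ‖(s' - s) • x‖ := by
          rw [hg_eq]
          exact norm_add₃_le
      _ ≤ δ * ‖r‖ + (‖A‖ + 1) * (c * δ) + k * δ * ‖x‖ := by
          rw [norm_smul, Real.norm_eq_abs]
          gcongr
          · exact (hadj H r).trans (by gcongr)
          · exact (hadj (A + H) e).trans (by gcongr)
      _ = M * δ := by rw [hM]; ring
  have hd : ‖d‖ ≤ M / γ * δ := by
    have h1 : γ * ‖d‖ ^ 2 ≤ M * δ * ‖d‖ := by
      rw [← hgd] at hcoer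
      exact hcoer.trans ((real_inner_le_norm g d).trans (by gcongr))
    rcases (norm_nonneg d).eq_or_lt with h0 | h0
    · rw [← h0]
      have : 0 ≤ M * δ := (norm_nonneg g).trans hgM
      rw [div_mul_eq_mul_div]
      positivity
    · rw [div_mul_eq_mul_div, le_div_iff₀ hγ]
      nlinarith
  have hd0 : 0 ≤ M / γ * δ := (norm_nonneg d).trans hd
  have hc0 : 0 ≤ c * δ := (norm_nonneg e).trans he
  have hk0 : 0 ≤ k * δ := (abs_nonneg _).trans hs
  refine ⟨adjoint H e + ((‖e‖ ^ 2 - inner ℝ g d) / (1 + ‖x‖ ^ 2)) • x -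
    (adjoint A (H d) + adjoint H (A d) + adjoint H (H d) - (s' - s) • d), ?_, ?_⟩
  · have h1 : ‖adjoint H e‖ ≤ δ * (c * δ) := (hadj H e).trans (by gcongr)
    have h2 : ‖((‖e‖ ^ 2 - inner ℝ g d) / (1 + ‖x‖ ^ 2)) • x‖ ≤
        ((c * δ) ^ 2 + M * δ * (M / γ * δ)) * ‖x‖ := by
      rw [norm_smul, norm_div, Real.norm_of_nonneg (zero_le_one.trans hN)]
      gcongr
      refine (div_le_self (norm_nonneg _) hN).trans ((norm_sub_le _ _).trans ?_)
      rw [Real.norm_of_nonneg (sq_nonneg ‖e‖)]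
      gcongr
      exact (norm_inner_le_norm g d).trans (by gcongr; exact (norm_nonneg g).trans hgM)
    have h3 : ‖adjoint A (H d)‖ ≤ ‖A‖ * (δ * (M / γ * δ)) :=
      (hadj A _).trans (by gcongr; exact (H.le_opNorm d).trans (by gcongr))
    have h4 : ‖adjoint H (A d)‖ ≤ δ * (‖A‖ * (M / γ * δ)) :=
      (hadj H _).trans (by gcongr; exact (A.le_opNorm d).trans (by gcongr))
    have h5 : ‖adjoint H (H d)‖ ≤ 1 * (δ * (M / γ * δ)) :=
      (hadj H _).trans
        (by gcongr; exacts [hH.trans hδ1, (H.le_opNorm d).trans (by gcongr)])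
    have h6 : ‖(s' - s) • d‖ ≤ k * δ * (M / γ * δ) := by
      rw [norm_smul, Real.norm_eq_abs]
      gcongr
    calc _ ≤ ‖adjoint H e‖ + ‖((‖e‖ ^ 2 - inner ℝ g d) / (1 + ‖x‖ ^ 2)) • x‖ +
          (‖adjoint A (H d)‖ + ‖adjoint H (A d)‖ + ‖adjoint H (H d)‖ + ‖(s' - s) • d‖) :=
          (norm_sub_le _ _).trans (add_le_add (norm_add_le _ _)
            ((norm_sub_le _ _).trans (add_le_add_left norm_add₃_le _)))
      _ ≤ δ * (c * δ) + ((c * δ) ^ 2 + M * δ * (M / γ * δ)) * ‖x‖ +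
          (‖A‖ * (δ * (M / γ * δ)) + δ * (‖A‖ * (M / γ * δ)) + 1 * (δ * (M / γ * δ)) +
            k * δ * (M / γ * δ)) := by gcongr
      _ = _ := by ring
  · generalize (‖e‖ ^ 2 - inner ℝ g d) / (1 + ‖x‖ ^ 2) = q at hs_eq ⊢
    have h1 : adjoint A (A d) - s • d =
        g - (adjoint A (H d) + adjoint H (A d) + adjoint H (H d) - (s' - s) • d) := by
      rw [hg]
      simp only [map_add, add_apply, sub_smul]
      abel
    have h2 : (s' - s) • x = (2 / (1 + ‖x‖ ^ 2) * inner ℝ r e) • x + q • x := by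
      rw [hs_eq, add_smul]
    rw [h1, hg_eq, h2, map_add, add_apply]
    abel

end Expansion

/-! ### The generic total least squares problem -/

namespace TLS

open ContinuousLinearMap (adjoint)

variable {m n : ℕ}

/-- The smallest singular value of `[A, b]`, squared, is a lower bound of
`‖b - A y‖² / (1 + ‖y‖²)`. -/
theorem singVal_augment_sq_mul_le (A : Matrix (Fin m) (Fin n) ℝ) (b : EuclideanSpace ℝ (Fin m))
    (y : EuclideanSpace ℝ (Fin n)) :
    singVal (augment A b) (n + 1) ^ 2 * (1 + ‖y‖ ^ 2) ≤ ‖b - toCLM A y‖ ^ 2 := by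
  have h1 := (Matrix.toEuclideanLin (augment A b)).last_singularValue_mul_norm_le (k := n)
    (by simp) (append y (-1))
  have h2 := pow_le_pow_left₀ (mul_nonneg (LinearMap.singularValues_nonneg _ _) (norm_nonneg _))
    h1 2
  have h3 : Matrix.toEuclideanLin (augment A b) (append y (-1)) = -(b - toCLM A y) := by
    rw [← LinearMap.coe_toContinuousLinearMap', toCLM_augment_append, neg_one_smul]
    abel
  rw [h3, norm_neg, mul_pow, norm_append_sq] at h2
  have h4 : singVal (augment A b) (n + 1) =
    (Matrix.toEuclideanLin (augment A b)).singularValues n := rfl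
  rw [h4]
  linarith

theorem singVal_nonneg {ι κ : Type*} [Fintype ι] [Fintype κ] [DecidableEq κ] (M : Matrix ι κ ℝ)
    (k : ℕ) : 0 ≤ singVal M k := LinearMap.singularValues_nonneg _ _

theorem singVal_mul_norm_le (hn : 0 < n) (A : Matrix (Fin m) (Fin n) ℝ)
    (y : EuclideanSpace ℝ (Fin n)) : singVal A n * ‖y‖ ≤ ‖toCLM A y‖ :=
  (Matrix.toEuclideanLin A).last_singularValue_mul_norm_le (k := n - 1) (by simp; omega) y

theorem abs_singVal_add_sub_le (hn : 0 < n) (A δA : Matrix (Fin m) (Fin n) ℝ) :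
    |singVal (A + δA) n - singVal A n| ≤ frobNorm δA := by
  have h := (Matrix.toEuclideanLin A).abs_last_singularValue_add_sub_le (Matrix.toEuclideanLin δA)
    (k := n - 1) (by simp; omega) (norm_toCLM_apply_le δA)
  rwa [← map_add] at h

theorem abs_singVal_augment_add_sub_le (A δA : Matrix (Fin m) (Fin n) ℝ)
    (b δb : EuclideanSpace ℝ (Fin m)) :
    |singVal (augment (A + δA) (b + δb)) (n + 1) - singVal (augment A b) (n + 1)| ≤
      frobNorm (augment δA δb) := by
  have h := (Matrix.toEuclideanLin (augment A b)).abs_last_singularValue_add_sub_le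
    (Matrix.toEuclideanLin (augment δA δb)) (k := n) (by simp)
    (norm_toCLM_apply_le (augment δA δb))
  rwa [← map_add, ← augment_add] at h

/-- For `s` below `singVal A n ^ 2` this says that `AᵀA - s` is positive definite. -/
theorem singVal_sq_sub_mul_norm_sq_le (hn : 0 < n) (A : Matrix (Fin m) (Fin n) ℝ)
    (s : ℝ) (y : EuclideanSpace ℝ (Fin n)) :
    (singVal A n ^ 2 - s) * ‖y‖ ^ 2 ≤ ‖toCLM A y‖ ^ 2 - s * ‖y‖ ^ 2 := by
  have h := pow_le_pow_left₀ (mul_nonneg (singVal_nonneg A n) (norm_nonneg y))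
    (singVal_mul_norm_le hn A y) 2
  rw [mul_pow] at h
  linarith

/-- Under genericity the last right singular vector of `[A, b]` has a nonzero last component, so
it can be scaled to `(x, -1)`. -/
theorem exists_norm_residual_sq_eq (hn : 0 < n) (A : Matrix (Fin m) (Fin n) ℝ)
    (b : EuclideanSpace ℝ (Fin m)) (hgen : singVal (augment A b) (n + 1) < singVal A n) :
    ∃ x, ‖b - toCLM A x‖ ^ 2 = singVal (augment A b) (n + 1) ^ 2 * (1 + ‖x‖ ^ 2) := by
  obtain ⟨z, hz0, hz⟩ := (Matrix.toEuclideanLin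
    (augment A b)).exists_norm_eq_last_singularValue_mul_norm (k := n) (by simp)
  obtain ⟨y, t, rfl⟩ := exists_eq_append z
  have hsq : ‖toCLM A y + t • b‖ ^ 2 =
      singVal (augment A b) (n + 1) ^ 2 * (‖y‖ ^ 2 + t ^ 2) := by
    rw [← toCLM_augment_append, ← norm_append_sq, ← mul_pow]
    exact congrArg (· ^ 2) hz
  have ht : t ≠ 0 := by
    rintro rfl
    have hy : y ≠ 0 := by
      rintro rfl
      refine hz0 (norm_eq_zero.1 (pow_eq_zero_iff two_ne_zero |>.1 ?_))
      simp [norm_append_sq]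
    rw [zero_smul, add_zero, zero_pow two_ne_zero, add_zero] at hsq
    have h1 := singVal_sq_sub_mul_norm_sq_le hn A (singVal (augment A b) (n + 1) ^ 2) y
    have h2 := pow_lt_pow_left₀ hgen (singVal_nonneg _ _) two_ne_zero
    have h3 : 0 < ‖y‖ ^ 2 := pow_pos (norm_pos_iff.2 hy) 2
    nlinarith
  refine ⟨-(t⁻¹ • y), ?_⟩
  have h1 : b - toCLM A (-(t⁻¹ • y)) = t⁻¹ • (toCLM A y + t • b) := by
    rw [map_neg, map_smul, smul_add, smul_smul, inv_mul_cancel₀ ht, one_smul]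
    abel
  rw [h1, norm_neg, norm_smul, norm_smul, mul_pow, mul_pow, hsq, Real.norm_eq_abs, sq_abs]
  field_simp
  ring

theorem isSolution_iff_eq (hn : 0 < n) {A : Matrix (Fin m) (Fin n) ℝ}
    {b : EuclideanSpace ℝ (Fin m)} (hgen : singVal (augment A b) (n + 1) < singVal A n)
    {x : EuclideanSpace ℝ (Fin n)}
    (hx : ‖b - toCLM A x‖ ^ 2 = singVal (augment A b) (n + 1) ^ 2 * (1 + ‖x‖ ^ 2))
    (y : EuclideanSpace ℝ (Fin n)) : IsSolution A b y ↔ y = x := by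
  have hpos : ∀ z : EuclideanSpace ℝ (Fin n), 0 < 1 + ‖z‖ ^ 2 := fun z => by positivity
  have hx' := (div_eq_iff (hpos x).ne').2 hx
  rw [isSolution_iff]
  constructor
  · intro h
    have h1 := h x
    rw [hx', div_le_iff₀ (hpos y)] at h1
    have h2 := norm_residual_add_sq_sub (toCLM A) b (singVal (augment A b) (n + 1) ^ 2) x (y - x)
    rw [adjoint_residual_add_smul_eq_zero (singVal_augment_sq_mul_le A b) hx, inner_zero_left,
      add_sub_cancel] at h2
    have h3 := singVal_sq_sub_mul_norm_sq_le hn A (singVal (augment A b) (n + 1) ^ 2) (y - x)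
    have h4 := pow_lt_pow_left₀ hgen (singVal_nonneg _ _) two_ne_zero
    have h5 : ‖y - x‖ ^ 2 = 0 := by nlinarith [sq_nonneg ‖y - x‖]
    exact sub_eq_zero.1 (norm_eq_zero.1 (pow_eq_zero_iff two_ne_zero |>.1 h5))
  · rintro rfl z
    rw [hx', le_div_iff₀ (hpos z)]
    exact singVal_augment_sq_mul_le A b z

/-! ### The shifted Gram matrix and the condition number -/

theorem toCLM_shiftedGram_apply (A : Matrix (Fin m) (Fin n) ℝ) (b : EuclideanSpace ℝ (Fin m))
    (y : EuclideanSpace ℝ (Fin n)) :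
    toCLM (shiftedGram A b) y =
      adjoint (toCLM A) (toCLM A y) - singVal (augment A b) (n + 1) ^ 2 • y := by
  have h : toCLM (shiftedGram A b) y =
      toCLM (Aᵀ * A) y - singVal (augment A b) (n + 1) ^ 2 • y := by
    simp [toCLM, shiftedGram]
  rw [h, toCLM_mul_apply, toCLM_transpose]

theorem isUnit_shiftedGram (hn : 0 < n) {A : Matrix (Fin m) (Fin n) ℝ}
    {b : EuclideanSpace ℝ (Fin m)} (hgen : singVal (augment A b) (n + 1) < singVal A n) :
    IsUnit (shiftedGram A b) := by
  rw [← Matrix.mulVec_injective_iff_isUnit, ← Matrix.coe_mulVecLin,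
    ← LinearMap.ker_eq_bot, LinearMap.ker_eq_bot']
  intro v hv
  have h1 : toCLM (shiftedGram A b) (WithLp.toLp 2 v) = 0 := by
    have : shiftedGram A b *ᵥ v = 0 := hv
    simp [toCLM, this]
  have h2 : ‖toCLM A (WithLp.toLp 2 v)‖ ^ 2 -
      singVal (augment A b) (n + 1) ^ 2 * ‖WithLp.toLp 2 v‖ ^ 2 = 0 := by
    rw [← real_inner_self_eq_norm_sq, ← ContinuousLinearMap.adjoint_inner_left,
      ← real_inner_self_eq_norm_sq, ← real_inner_smul_left, ← inner_sub_left,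
      ← toCLM_shiftedGram_apply, h1, inner_zero_left]
  have h3 := singVal_sq_sub_mul_norm_sq_le hn A (singVal (augment A b) (n + 1) ^ 2) (WithLp.toLp 2 v)
  have h4 := pow_lt_pow_left₀ hgen (singVal_nonneg _ _) two_ne_zero
  have h5 : ‖WithLp.toLp 2 v‖ ^ 2 = 0 := by nlinarith [sq_nonneg ‖WithLp.toLp 2 v‖]
  simpa using h5

open scoped Matrix.Norms.L2Operator in
/-- The spectral norm of a matrix depends only on its Gram matrix of rows. -/
theorem specNorm_eq_of_mul_transpose_eq {ι κ : Type*} [Fintype ι] [Fintype κ]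
    [DecidableEq ι] [DecidableEq κ] {M N : Matrix ι κ ℝ} (h : M * Mᵀ = N * Nᵀ) :
    specNorm M = specNorm N := by
  have hsq : ∀ P : Matrix ι κ ℝ, ‖P * Pᵀ‖ = specNorm P * specNorm P := fun P => by
    have h1 := Matrix.l2_opNorm_conjTranspose_mul_self Pᴴ
    rwa [Matrix.conjTranspose_conjTranspose, Matrix.l2_opNorm_conjTranspose,
      Matrix.conjTranspose_eq_transpose_of_trivial] at h1
  have h1 : specNorm M * specNorm M = specNorm N * specNorm N := by
    rw [← hsq M, ← hsq N, h]
  exact (mul_self_inj (norm_nonneg _) (norm_nonneg _)).1 h1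

/-- The rank-one term of the derivative does not change the row Gram matrix: `Aᵀ r = -s x` and
`‖r‖² = s (1 + ‖x‖²)` make the terms in `x xᵀ` cancel. -/
theorem mul_transpose_add_rankOne (A : Matrix (Fin m) (Fin n) ℝ) {x : EuclideanSpace ℝ (Fin n)}
    {r : EuclideanSpace ℝ (Fin m)} {s : ℝ} (hst : adjoint (toCLM A) r + s • x = 0)
    (hr : ‖r‖ ^ 2 = s * (1 + ‖x‖ ^ 2)) :
    (Aᵀ + (2 / (1 + ‖x‖ ^ 2)) • Matrix.vecMulVec x.ofLp r.ofLp) *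
      (Aᵀ + (2 / (1 + ‖x‖ ^ 2)) • Matrix.vecMulVec x.ofLp r.ofLp)ᵀ = Aᵀ * A := by
  have h1 : Aᵀ *ᵥ r.ofLp = -(s • x.ofLp) := by
    rw [← toCLM_transpose] at hst
    have := congrArg WithLp.ofLp (eq_neg_of_add_eq_zero_left hst)
    simpa [toCLM] using this
  have h2 : r.ofLp ᵥ* A = -(s • x.ofLp) := by rw [← Matrix.mulVec_transpose, h1]
  have h3 : r.ofLp ⬝ᵥ r.ofLp = s * (1 + ‖x‖ ^ 2) := by
    rw [← hr, EuclideanSpace.real_norm_sq_eq, dotProduct]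
    exact Finset.sum_congr rfl fun i _ => (sq _).symm
  have hN : 1 + ‖x‖ ^ 2 ≠ 0 := by positivity
  rw [Matrix.transpose_add, Matrix.transpose_smul, Matrix.transpose_vecMulVec,
    Matrix.transpose_transpose, Matrix.add_mul, Matrix.mul_add, Matrix.mul_add, Matrix.mul_smul,
    Matrix.mul_vecMulVec, Matrix.smul_mul, Matrix.vecMulVec_mul, Matrix.smul_mul, Matrix.mul_smul,
    Matrix.vecMulVec_mul_vecMulVec, h1, h2, h3]
  ext i j
  simp only [Matrix.add_apply, Matrix.smul_apply, Matrix.vecMulVec_apply, Pi.neg_apply,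
    Pi.smul_apply, smul_eq_mul]
  field_simp
  ring

theorem specNorm_inv_mul_add_rankOne (A : Matrix (Fin m) (Fin n) ℝ)
    (G : Matrix (Fin n) (Fin n) ℝ) {x : EuclideanSpace ℝ (Fin n)}
    {r : EuclideanSpace ℝ (Fin m)} {s : ℝ} (hst : adjoint (toCLM A) r + s • x = 0)
    (hr : ‖r‖ ^ 2 = s * (1 + ‖x‖ ^ 2)) :
    specNorm (G * (Aᵀ + (2 / (1 + ‖x‖ ^ 2)) • Matrix.vecMulVec x.ofLp r.ofLp)) =
      specNorm (G * Aᵀ) := by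
  refine specNorm_eq_of_mul_transpose_eq ?_
  rw [Matrix.transpose_mul, Matrix.transpose_mul, Matrix.mul_assoc, ← Matrix.mul_assoc _ _ Gᵀ,
    mul_transpose_add_rankOne A hst hr, Matrix.transpose_transpose]
  simp only [Matrix.mul_assoc]

theorem toCLM_add_rankOne_apply (A : Matrix (Fin m) (Fin n) ℝ) (c : ℝ)
    (x : EuclideanSpace ℝ (Fin n)) (r e : EuclideanSpace ℝ (Fin m)) :
    toCLM (Aᵀ + c • Matrix.vecMulVec x.ofLp r.ofLp) e =
      adjoint (toCLM A) e + (c * inner ℝ r e) • x := by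
  rw [← toCLM_transpose]
  ext i
  simp only [toCLM, Matrix.toLpLin_apply, LinearMap.coe_toContinuousLinearMap', Matrix.add_mulVec,
    Matrix.smul_mulVec, Matrix.vecMulVec_mulVec, PiLp.add_apply, PiLp.smul_apply, Pi.add_apply,
    Pi.smul_apply, smul_eq_mul, EuclideanSpace.inner_eq_star_dotProduct, star_trivial,
    MulOpposite.smul_eq_mul_unop, MulOpposite.unop_op]
  rw [dotProduct_comm r.ofLp]
  ring

end TLS

/-! ### Perturbation bound -/

namespace TLS

open ContinuousLinearMap (adjoint)

variable {m n : ℕ}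

/-- The perturbation bound before division by `‖x‖`; the first-order part is the norm of
`K (δb - δA x) + G⁻¹ δAᵀ r`, where `G` is the shifted Gram matrix and
`K = G⁻¹ (Aᵀ + 2 x rᵀ / (1 + ‖x‖²))` has the same norm as `G⁻¹ Aᵀ`. -/
theorem exists_perturbation_bound (hn : 0 < n) (A : Matrix (Fin m) (Fin n) ℝ)
    (b : EuclideanSpace ℝ (Fin m)) (hgen : singVal (augment A b) (n + 1) < singVal A n)
    {x : EuclideanSpace ℝ (Fin n)}
    (hx : ‖b - toCLM A x‖ ^ 2 = singVal (augment A b) (n + 1) ^ 2 * (1 + ‖x‖ ^ 2)) :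
    ∃ ε > (0 : ℝ), ∃ C : ℝ, ∀ (δA : Matrix (Fin m) (Fin n) ℝ) (δb : EuclideanSpace ℝ (Fin m)),
      frobNorm (augment δA δb) < ε →
      ∃ δx : EuclideanSpace ℝ (Fin n),
        (∀ y, IsSolution (A + δA) (b + δb) y ↔ y = x + δx) ∧
        ‖δx‖ ≤ specNorm ((shiftedGram A b)⁻¹ * Aᵀ) * (‖δb‖ + specNorm δA * ‖x‖) +
          specNorm (shiftedGram A b)⁻¹ * (specNorm δA * ‖b - toCLM A x‖) +
          C * frobNorm (augment δA δb) ^ 2 := by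
  set σ := singVal (augment A b) (n + 1) with hσ
  set τ := singVal A n with hτ
  set r := b - toCLM A x with hr
  set G := shiftedGram A b with hG
  have hσ0 : 0 ≤ σ := singVal_nonneg _ _
  have hst : adjoint (toCLM A) r + σ ^ 2 • x = 0 :=
    adjoint_residual_add_smul_eq_zero (singVal_augment_sq_mul_le A b) hx
  have hγ : 0 < ((τ - σ) / 2) ^ 2 := by
    have := sub_pos.2 hgen
    positivity
  obtain ⟨R, hR⟩ := exists_first_order_expansion (toCLM A) (1 + ‖x‖) (2 * σ + 1) hγ hst hx
  -- `σ` and `τ` each move by at most `δ`, so a quarter of the gap leaves half of it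
  refine ⟨min 1 ((τ - σ) / 4), lt_min one_pos (by linarith), specNorm G⁻¹ * R, ?_⟩
  intro δA δb hδ
  set δ := frobNorm (augment δA δb) with hδdef
  have hδ0 : 0 ≤ δ := frobNorm_nonneg _
  have hδ1 : δ < 1 := hδ.trans_le (min_le_left _ _)
  have hδ2 : δ < (τ - σ) / 4 := hδ.trans_le (min_le_right _ _)
  set σ' := singVal (augment (A + δA) (b + δb)) (n + 1) with hσ'
  set τ' := singVal (A + δA) n with hτ'
  have hσσ : |σ' - σ| ≤ δ := abs_singVal_augment_add_sub_le A δA b δb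
  have hττ : |τ' - τ| ≤ δ :=
    (abs_singVal_add_sub_le hn A δA).trans (frobNorm_le_frobNorm_augment δA δb)
  have hσ'0 : 0 ≤ σ' := singVal_nonneg _ _
  have hgap : (τ - σ) / 2 ≤ τ' - σ' := by
    linarith [(abs_le.1 hσσ).2, (abs_le.1 hττ).1]
  have hgen' : σ' < τ' := by linarith
  obtain ⟨x', hx'⟩ := exists_norm_residual_sq_eq hn (A + δA) (b + δb) hgen'
  have hst' := adjoint_residual_add_smul_eq_zero
    (singVal_augment_sq_mul_le (A + δA) (b + δb)) hx'
  obtain ⟨d, rfl⟩ : ∃ d, x' = x + d := ⟨x' - x, (add_sub_cancel x x').symm⟩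
  have hadd : toCLM (A + δA) = toCLM A + toCLM δA := by simp [toCLM]
  set e := δb - toCLM δA x with he
  have hres : b + δb - toCLM (A + δA) (x + d) = r + e - (toCLM A + toCLM δA) d := by
    rw [hadd, map_add, hr, he, add_apply, add_apply]
    abel
  have hH : ‖toCLM δA‖ ≤ δ :=
    (specNorm_le_frobNorm δA).trans (frobNorm_le_frobNorm_augment δA δb)
  have hnorm_e : ‖e‖ ≤ ‖δb‖ + specNorm δA * ‖x‖ :=
    (norm_sub_le _ _).trans (add_le_add_right ((toCLM δA).le_opNorm x) _)
  have hδb : ‖δb‖ ≤ δ := norm_le_frobNorm_augment δA δb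
  have hle_e : ‖e‖ ≤ (1 + ‖x‖) * δ := by
    have h1 : specNorm δA * ‖x‖ ≤ δ * ‖x‖ := mul_le_mul_of_nonneg_right hH (norm_nonneg x)
    linarith
  have hss : |σ' ^ 2 - σ ^ 2| ≤ (2 * σ + 1) * δ := by
    rw [sq_sub_sq, abs_mul, abs_of_nonneg (add_nonneg hσ'0 hσ0)]
    have h1 : σ' + σ ≤ 2 * σ + 1 := by linarith [(abs_le.1 hσσ).2]
    exact mul_le_mul h1 hσσ (abs_nonneg _) (by linarith)
  have hcoer : ((τ - σ) / 2) ^ 2 * ‖d‖ ^ 2 ≤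
      ‖(toCLM A + toCLM δA) d‖ ^ 2 - σ' ^ 2 * ‖d‖ ^ 2 := by
    rw [← hadd]
    refine le_trans ?_ (singVal_sq_sub_mul_norm_sq_le hn (A + δA) (σ' ^ 2) d)
    have h1 : ((τ - σ) / 2) ^ 2 ≤ τ' ^ 2 - σ' ^ 2 := by nlinarith
    exact mul_le_mul_of_nonneg_right h1 (sq_nonneg _)
  obtain ⟨ρ, hρ, hexp⟩ := hR (toCLM δA) d e (σ' ^ 2) δ hδ1.le hH hle_e hss
    (by rwa [← hres, ← hadd]) (by rwa [← hres]) hcoer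
  refine ⟨d, isSolution_iff_eq hn hgen' hx', ?_⟩
  set K := G⁻¹ * (Aᵀ + (2 / (1 + ‖x‖ ^ 2)) • Matrix.vecMulVec x.ofLp r.ofLp) with hK
  have hd : d = toCLM K e + toCLM G⁻¹ (adjoint (toCLM δA) r) + toCLM G⁻¹ ρ := by
    have hdet : IsUnit G.det := (Matrix.isUnit_iff_isUnit_det G).1 (isUnit_shiftedGram hn hgen)
    have h1 : toCLM G⁻¹ (toCLM G d) = d := by
      rw [← toCLM_mul_apply, Matrix.nonsing_inv_mul G hdet]
      simp [toCLM]
    rw [← toCLM_shiftedGram_apply, ← toCLM_add_rankOne_apply] at hexp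
    rw [hK, toCLM_mul_apply, ← map_add, ← map_add, ← hexp, h1]
  have hKe : ‖toCLM K e‖ ≤ specNorm (G⁻¹ * Aᵀ) * (‖δb‖ + specNorm δA * ‖x‖) := by
    rw [← specNorm_inv_mul_add_rankOne A G⁻¹ hst hx]
    exact ((toCLM K).le_opNorm e).trans (mul_le_mul_of_nonneg_left hnorm_e (norm_nonneg _))
  have hGr : ‖toCLM G⁻¹ (adjoint (toCLM δA) r)‖ ≤ specNorm G⁻¹ * (specNorm δA * ‖r‖) := by
    refine ((toCLM G⁻¹).le_opNorm _).trans (mul_le_mul_of_nonneg_left ?_ (norm_nonneg _))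
    refine ((adjoint (toCLM δA)).le_opNorm r).trans ?_
    rw [LinearIsometryEquiv.norm_map]
    exact le_rfl
  have hGρ : ‖toCLM G⁻¹ ρ‖ ≤ specNorm G⁻¹ * R * δ ^ 2 := by
    rw [mul_assoc]
    exact ((toCLM G⁻¹).le_opNorm ρ).trans (mul_le_mul_of_nonneg_left hρ (norm_nonneg _))
  calc ‖d‖ ≤ ‖toCLM K e‖ + ‖toCLM G⁻¹ (adjoint (toCLM δA) r)‖ + ‖toCLM G⁻¹ ρ‖ := by
        conv_lhs => rw [hd]
        exact norm_add₃_le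
    _ ≤ _ := add_le_add (add_le_add hKe hGr) hGρ

end TLS

/-- First-order perturbation bound for total least squares. -/
theorem mainTheorem1 {m n : ℕ} (hn : 0 < n) (hmn : n ≤ m)
    (A : Matrix (Fin m) (Fin n) ℝ) (b : EuclideanSpace ℝ (Fin m))
    (hgen : TLS.singVal (TLS.augment A b) (n + 1) < TLS.singVal A n) :
    IsUnit (TLS.shiftedGram A b) ∧
    ∃ (x : EuclideanSpace ℝ (Fin n)) (r : EuclideanSpace ℝ (Fin m)),
      TLS.IsSolution A b x ∧ (∀ y, TLS.IsSolution A b y → y = x) ∧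
      r = b - Matrix.toEuclideanLin A x ∧
      TLS.specNorm ((TLS.shiftedGram A b)⁻¹ *
          (Aᵀ + (2 / (1 + ‖x‖ ^ 2)) • Matrix.vecMulVec x.ofLp r.ofLp)) =
        TLS.specNorm ((TLS.shiftedGram A b)⁻¹ * Aᵀ) ∧
      ∃ ε > (0 : ℝ), ∃ C : ℝ,
        ∀ (δA : Matrix (Fin m) (Fin n) ℝ) (δb : EuclideanSpace ℝ (Fin m)),
          TLS.frobNorm (TLS.augment δA δb) < ε →
          ∃ δx : EuclideanSpace ℝ (Fin n),
            TLS.IsSolution (A + δA) (b + δb) (x + δx) ∧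
            (∀ y, TLS.IsSolution (A + δA) (b + δb) y → y = x + δx) ∧
            (x ≠ 0 →
              ‖δx‖ / ‖x‖ ≤
                (‖b‖ / ‖x‖ * TLS.specNorm ((TLS.shiftedGram A b)⁻¹ * Aᵀ)) * (‖δb‖ / ‖b‖)
                + (TLS.specNorm A * ‖r‖ / ‖x‖ * TLS.specNorm (TLS.shiftedGram A b)⁻¹
                    + TLS.specNorm A * TLS.specNorm ((TLS.shiftedGram A b)⁻¹ * Aᵀ))
                  * (TLS.specNorm δA / TLS.specNorm A)
                + C * TLS.frobNorm (TLS.augment δA δb) ^ 2) := by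
  obtain ⟨x, hx⟩ := TLS.exists_norm_residual_sq_eq hn A b hgen
  have hsol := TLS.isSolution_iff_eq hn hgen hx
  have hst := adjoint_residual_add_smul_eq_zero (TLS.singVal_augment_sq_mul_le A b) hx
  refine ⟨TLS.isUnit_shiftedGram hn hgen, x, _, (hsol x).2 rfl, fun y => (hsol y).1, rfl,
    TLS.specNorm_inv_mul_add_rankOne A _ hst hx, ?_⟩
  obtain ⟨ε, hε, C, hC⟩ := TLS.exists_perturbation_bound hn A b hgen hx
  refine ⟨ε, hε, C / ‖x‖, fun δA δb hδ => ?_⟩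
  obtain ⟨δx, hδx, hle⟩ := hC δA δb hδ
  refine ⟨δx, (hδx _).2 rfl, fun y => (hδx y).1, fun hx0 => ?_⟩
  have hxpos : 0 < ‖x‖ := norm_pos_iff.2 hx0
  -- the bound divides by `‖A‖` and `‖b‖`, both nonzero: `A` is injective, and `b = 0` forces `x = 0`
  have hA : TLS.specNorm A ≠ 0 := by
    intro h0
    have h1 := TLS.singVal_mul_norm_le hn A x
    have h2 : ‖TLS.toCLM A x‖ ≤ TLS.specNorm A * ‖x‖ := (TLS.toCLM A).le_opNorm x
    rw [h0, zero_mul] at h2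
    have h3 := (TLS.singVal_nonneg (TLS.augment A b) (n + 1)).trans_lt hgen
    nlinarith
  have hb : ‖b‖ ≠ 0 := by
    intro h0
    refine hx0 (((hsol 0).1 ?_).symm)
    rw [TLS.isSolution_iff]
    intro y
    rw [map_zero, sub_zero, h0, zero_pow two_ne_zero, zero_div]
    positivity
  refine ((div_le_div_iff_of_pos_right hxpos).2 hle).trans (le_of_eq ?_)
  change _ = _ + (_ * ‖b - TLS.toCLM A x‖ / _ * _ + _) * _ + _
  field_simp
  ring
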